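/- Let $d\ge 0$ and $n\ge 1$ be integers, and let $\boldsymbol A=(A_1,\dots,A_d)$ be a doubly commuting tuple of complex $n\times n$ matrices, that is, $A_iA_j=A_jA_i$ and $A_i^*A_j=A_jA_i^*$ for all $i\neq j$. Regard $\boldsymbol A$ as the operator $\mathbb C^n\to(\mathbb C^n)^d$, $\boldsymbol A x=(A_1x,\dots,A_dx)$, where $(\mathbb C^n)^d$ is the Hilbert space direct sum, and let $\|\boldsymbol A\|=\big\|\sum_{j=1}^d A_j^*A_j\big\|^{1/2}$ be its operator norm. For $\boldsymbol z=(z_1,\dots,z_d)\in\mathbb C^d$ let $\boldsymbol z\boldsymbol I=(z_1I,\dots,z_dI)$, and put $\operatorname{dist}(\boldsymbol A,\mathbb C^d\boldsymbol I)=\inf_{\boldsymbol z\in\mathbb C^d}\|\boldsymbol A-\boldsymbol z\boldsymbol I\|$. For $x\in\mathbb C^n$ let $\operatorname{var}_x(\boldsymbol A)=\|\boldsymbol Ax\|^2-\sum_{j=1}^d|\langle x|A_jx\rangle|^2$. Then the infimum defining $\operatorname{dist}(\boldsymbol A,\mathbb C^d\boldsymbol I)$ is a minimum, the maximum of $\operatorname{var}_x(\boldsymbol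 A)$ over unit vectors $x\in\mathbb C^n$ is attained, and $$\operatorname{dist}(\boldsymbol A,\mathbb C^d\boldsymbol I)^2=\max_{\|x\|=1}\operatorname{var}_x(\boldsymbol A).$$ -/

import Mathlib

open scoped Matrix

/-- A tuple of matrices is doubly commuting if `A i` commutes with `A j` and its conjugate
transpose commutes with `A j` whenever `i ≠ j` (nothing is required for `i = j`). -/
def DoublyCommuting {d n : ℕ} (A : Fin d → Matrix (Fin n) (Fin n) ℂ) : Prop :=
  ∀ i j, i ≠ j → A i * A j = A j * A i ∧ (A i)ᴴ * A j = A j * (A i)ᴴ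

noncomputable section

/-- The tuple as the operator `x ↦ (A₁ x, …, A_d x)` from `ℂⁿ` to the Hilbert direct sum of `d`
copies of `ℂⁿ`. Its norm is the operator norm. -/
def tupleOp {d n : ℕ} (A : Fin d → Matrix (Fin n) (Fin n) ℂ) :
    EuclideanSpace ℂ (Fin n) →L[ℂ] PiLp 2 (fun _ : Fin d => EuclideanSpace ℂ (Fin n)) :=
  ((PiLp.continuousLinearEquiv 2 ℂ
      (fun _ : Fin d => EuclideanSpace ℂ (Fin n))).symm.toContinuousLinearMap).comp
    (ContinuousLinearMap.pi fun j => Matrix.toEuclideanCLM (n := Fin n) (𝕜 := ℂ) (A j))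

/-- The tuple `zI = (z₁ I, …, z_d I)`. -/
def scalarTuple {d : ℕ} (n : ℕ) (z : Fin d → ℂ) : Fin d → Matrix (Fin n) (Fin n) ℂ :=
  fun j => z j • (1 : Matrix (Fin n) (Fin n) ℂ)

/-- The distance of a tuple from the scalar tuples: the infimum of `‖A - zI‖` over `z ∈ ℂᵈ`. -/
def distToScalars {d n : ℕ} (A : Fin d → Matrix (Fin n) (Fin n) ℂ) : ℝ :=
  ⨅ z : Fin d → ℂ, ‖tupleOp (A - scalarTuple n z)‖

/-- The variance `‖A x‖² - ∑ⱼ |⟨x, Aⱼ x⟩|²` of a tuple with respect to `x`. -/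
def tupleVar {d n : ℕ} (A : Fin d → Matrix (Fin n) (Fin n) ℂ) (x : EuclideanSpace ℂ (Fin n)) : ℝ :=
  ‖tupleOp A x‖ ^ 2
    - ∑ j, ‖inner ℂ x (Matrix.toEuclideanCLM (n := Fin n) (𝕜 := ℂ) (A j) x)‖ ^ 2

end

/-!
For a unit vector `x` the number `‖(A - zI) x‖²` is the variance of `A` at `x` plus the squared
distance from `z` to the vector of expectations `⟪x, A j x⟫`. So `z` can be an optimal choice with
value `M` only if, for every direction `c`, some top eigenvector of `S = ∑ j, (B j)* B j`, where
`B j = A j - z j`, has expectations with nonpositive component along `c`: otherwise moving `z` a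
little along `c` would lower the norm. If the expectations on the unit sphere of the top eigenspace
of `S` form a convex set, that set must then contain `0`, and a top eigenvector with zero
expectations has variance exactly `M`.

For the convexity, first replace `B j` by its part commuting with `(B j)* B j`; the remainder is a
commutator with `S`, so it has zero expectation on eigenvectors of `S`, and now the eigenspace is
reducing. The joint numerical range of doubly commuting operators over a reducing subspace is convex
by induction on their number. On a minimal reducing subspace `U` of one operator `T`, the algebra
`C` of operators doubly commuting with `T` acts by scalars (Schur), so `C • U` behaves like a tensor
product on which `T` and the other operators act in different factors. The two partial traces of a
sum of states are realised by pure states, by Toeplitz–Hausdorff for `T` and by induction for the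
others, and a product vector combines them.
-/

open scoped InnerProductSpace

section NumericalRange

variable {E : Type*} [NormedAddCommGroup E] [InnerProductSpace ℂ E]

/-- The map `x ↦ (⟪x, S x⟫)_{S ∈ 𝒮}` takes a set of values on `V` that is closed under addition.
When `1 ∈ 𝒮`, this is the homogeneous form of convexity of the joint numerical range of `𝒮` over
the unit vectors of `V`. -/
def QuadAdditive (𝒮 : Set (E →L[ℂ] E)) (V : Submodule ℂ E) : Prop :=
  ∀ x ∈ V, ∀ y ∈ V, ∃ w ∈ V, ∀ S ∈ 𝒮, ⟪w, S w⟫_ℂ = ⟪x, S x⟫_ℂ + ⟪y, S y⟫_ℂ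

theorem QuadAdditive.exists_sum {𝒮 : Set (E →L[ℂ] E)} {V : Submodule ℂ E} (h : QuadAdditive 𝒮 V)
    {κ : Type*} (t : Finset κ) {x : κ → E} (hx : ∀ i, x i ∈ V) :
    ∃ w ∈ V, ∀ S ∈ 𝒮, ⟪w, S w⟫_ℂ = ∑ i ∈ t, ⟪x i, S (x i)⟫_ℂ := by
  classical
  induction t using Finset.induction_on with
  | empty => exact ⟨0, V.zero_mem, by simp⟩
  | insert i t hi ih =>
    obtain ⟨w, hw, hwS⟩ := ih
    obtain ⟨w', hw', hwS'⟩ := h (x i) (hx i) w hw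
    exact ⟨w', hw', fun S hS => by rw [hwS' S hS, hwS S hS, Finset.sum_insert hi]⟩

theorem exists_norm_eq_one_im_mul_add_conj_mul_eq_zero (g h : ℂ) :
    ∃ z : ℂ, ‖z‖ = 1 ∧ (z * g + starRingEnd ℂ z * h).im = 0 := by
  obtain ⟨z, hz, hzk⟩ := RCLike.exists_norm_eq_mul_self (g - starRingEnd ℂ h)
  refine ⟨z, hz, ?_⟩
  calc (z * g + starRingEnd ℂ z * h).im = (z * (g - starRingEnd ℂ h)).im := by
        simp only [Complex.add_im, Complex.mul_im, Complex.sub_re, Complex.sub_im, Complex.conj_re,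
          Complex.conj_im]
        ring
    _ = 0 := by rw [← hzk]; exact Complex.ofReal_im _

theorem exists_ne_zero_inner_apply_eq_zero_of_one_of_neg_one (T : E →L[ℂ] E) {V : Submodule ℂ E}
    {x y : E} (hx : x ∈ V) (hy : y ∈ V) (hTx : ⟪x, T x⟫_ℂ = 1) (hTy : ⟪y, T y⟫_ℂ = -1) :
    ∃ w ∈ V, w ≠ 0 ∧ ⟪w, T w⟫_ℂ = 0 := by
  obtain ⟨z, hz, hreal⟩ :=
    exists_norm_eq_one_im_mul_add_conj_mul_eq_zero ⟪x, T y⟫_ℂ ⟪y, T x⟫_ℂ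
  set r := (z * ⟪x, T y⟫_ℂ + starRingEnd ℂ z * ⟪y, T x⟫_ℂ).re
  have hcross : z * ⟪x, T y⟫_ℂ + starRingEnd ℂ z * ⟪y, T x⟫_ℂ = r :=
    Complex.ext rfl (by rw [hreal, Complex.ofReal_im])
  have hzz : starRingEnd ℂ z * z = 1 := by rw [Complex.conj_mul', hz]; simp
  obtain ⟨s, hs⟩ := exists_quadratic_eq_zero (K := ℝ) (a := -1) (b := r) (c := 1) (by norm_num)
    ⟨√(r ^ 2 + 4), by rw [Real.mul_self_sqrt (by positivity), discrim]; ring⟩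
  have hs' : (-1 : ℂ) * (s * s) + r * s + 1 = 0 := by exact_mod_cast hs
  refine ⟨x + ((s : ℂ) * z) • y, V.add_mem hx (V.smul_mem _ hy), fun h0 => ?_, ?_⟩
  · have hval := hTx
    rw [eq_neg_of_add_eq_zero_left h0] at hval
    simp only [map_neg, map_smul, inner_neg_neg, inner_smul_left, inner_smul_right, hTy, map_mul,
      Complex.conj_ofReal] at hval
    have : (1 : ℂ) + (s ^ 2 : ℝ) = 0 := by
      push_cast
      linear_combination -hval - (s : ℂ) ^ 2 * hzz
    have : 1 + s ^ 2 = 0 := by exact_mod_cast this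
    nlinarith
  · simp only [map_add, map_smul, inner_add_left, inner_add_right, inner_smul_left,
      inner_smul_right, hTx, hTy, map_mul, Complex.conj_ofReal]
    linear_combination (s : ℂ) * hcross - (s : ℂ) ^ 2 * hzz + hs'

theorem exists_ne_zero_inner_apply_eq_zero (T : E →L[ℂ] E) {V : Submodule ℂ E} {x y : E}
    (hx : x ∈ V) (hy : y ∈ V) (hx0 : x ≠ 0) (h : ⟪x, T x⟫_ℂ + ⟪y, T y⟫_ℂ = 0) :
    ∃ w ∈ V, w ≠ 0 ∧ ⟪w, T w⟫_ℂ = 0 := by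
  set a := ⟪x, T x⟫_ℂ with ha
  rcases eq_or_ne a 0 with ha0 | ha0
  · exact ⟨x, hx, hx0, ha ▸ ha0⟩
  obtain ⟨w, hw, hw0, hwT⟩ :=
    exists_ne_zero_inner_apply_eq_zero_of_one_of_neg_one (a⁻¹ • T) hx hy
      (by rw [smul_apply, inner_smul_right, ← ha, inv_mul_cancel₀ ha0])
      (by rw [smul_apply, inner_smul_right, eq_neg_of_add_eq_zero_right h, mul_neg,
        inv_mul_cancel₀ ha0])
  refine ⟨w, hw, hw0, ?_⟩
  rw [smul_apply, inner_smul_right] at hwT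
  exact (mul_eq_zero.mp hwT).resolve_left (inv_ne_zero ha0)

theorem inner_ofReal_smul_apply (T : E →L[ℂ] E) (r : ℝ) (x : E) :
    ⟪(r : ℂ) • x, T ((r : ℂ) • x)⟫_ℂ = (r : ℂ) ^ 2 * ⟪x, T x⟫_ℂ := by
  rw [map_smul, inner_smul_left, inner_smul_right, Complex.conj_ofReal]
  ring

/-- The Toeplitz–Hausdorff theorem. -/
theorem quadAdditive_pair_one (T : E →L[ℂ] E) (V : Submodule ℂ E) : QuadAdditive {1, T} V := by
  intro x hx y hy
  rcases eq_or_ne x 0 with rfl | hx0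
  · exact ⟨y, hy, fun S _ => by simp⟩
  have hpos : 0 < ‖x‖ ^ 2 + ‖y‖ ^ 2 := by positivity
  have hpos' : ((‖x‖ : ℂ) ^ 2 + (‖y‖ : ℂ) ^ 2) ≠ 0 := by exact_mod_cast hpos.ne'
  set c := (⟪x, T x⟫_ℂ + ⟪y, T y⟫_ℂ) / ((‖x‖ : ℂ) ^ 2 + (‖y‖ : ℂ) ^ 2) with hc
  have hshift : ∀ v, ⟪v, (T - c • 1) v⟫_ℂ = ⟪v, T v⟫_ℂ - c * (‖v‖ : ℂ) ^ 2 := fun v => by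
    simp
  obtain ⟨w, hw, hw0, hwT⟩ := exists_ne_zero_inner_apply_eq_zero (T - c • 1) hx hy hx0 (by
    rw [hshift, hshift, hc]
    field_simp
    ring)
  rw [hshift, sub_eq_zero] at hwT
  have hw0' : (‖w‖ : ℂ) ≠ 0 := by simpa using hw0
  have hsq : ((√(‖x‖ ^ 2 + ‖y‖ ^ 2) : ℝ) : ℂ) ^ 2 = (‖x‖ : ℂ) ^ 2 + (‖y‖ : ℂ) ^ 2 := by
    exact_mod_cast Real.sq_sqrt hpos.le
  refine ⟨((√(‖x‖ ^ 2 + ‖y‖ ^ 2) / ‖w‖ : ℝ) : ℂ) • w, V.smul_mem _ hw, ?_⟩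
  rintro S (rfl | rfl) <;> rw [inner_ofReal_smul_apply]
  · simp only [one_apply_eq_self, inner_self_eq_norm_sq_to_K, Complex.ofReal_div, div_pow, hsq,
      Complex.coe_algebraMap]
    field_simp
  · rw [hwT, hc, Complex.ofReal_div, div_pow, hsq]
    field_simp

end NumericalRange

section Reducing

variable {E : Type*} [NormedAddCommGroup E] [InnerProductSpace ℂ E] [CompleteSpace E]

/-- The algebra of operators having `V` as a reducing subspace: `V` and `Vᗮ` are both invariant. -/
noncomputable def reducedBy (V : Submodule ℂ E) [V.HasOrthogonalProjection] :
    StarSubalgebra ℂ (E →L[ℂ] E) :=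
  StarSubalgebra.centralizer ℂ {V.starProjection}

theorem mem_reducedBy_iff_commute {V : Submodule ℂ E} [V.HasOrthogonalProjection]
    {T : E →L[ℂ] E} : T ∈ reducedBy V ↔ Commute V.starProjection T := by
  simp [reducedBy, StarSubalgebra.mem_centralizer_iff, (isSelfAdjoint_starProjection V).star_eq,
    Commute, SemiconjBy]

theorem mem_reducedBy_iff {V : Submodule ℂ E} [V.HasOrthogonalProjection] {T : E →L[ℂ] E} :
    T ∈ reducedBy V ↔ (∀ x ∈ V, T x ∈ V) ∧ ∀ x ∈ V, star T x ∈ V := by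
  rw [mem_reducedBy_iff_commute,
    ContinuousLinearMap.IsIdempotentElem.commute_iff V.isIdempotentElem_starProjection,
    Submodule.range_starProjection, Submodule.ker_starProjection,
    ← ContinuousLinearMap.mem_invtSubmodule_adjoint_iff]
  rfl

theorem apply_mem_of_mem_reducedBy {V : Submodule ℂ E} [V.HasOrthogonalProjection]
    {T : E →L[ℂ] E} (hT : T ∈ reducedBy V) {x : E} (hx : x ∈ V) : T x ∈ V :=
  (mem_reducedBy_iff.mp hT).1 x hx

theorem reducedBy_orthogonal (V : Submodule ℂ E) [V.HasOrthogonalProjection] :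
    reducedBy Vᗮ = reducedBy V := by
  ext T
  simp [mem_reducedBy_iff_commute, Submodule.starProjection_orthogonal', Commute, SemiconjBy,
    sub_mul, mul_sub]

theorem reducedBy_inf_le (V W : Submodule ℂ E) [V.HasOrthogonalProjection]
    [W.HasOrthogonalProjection] [(V ⊓ W).HasOrthogonalProjection] :
    reducedBy V ⊓ reducedBy W ≤ reducedBy (V ⊓ W) := by
  rintro T ⟨hV, hW⟩
  obtain ⟨hV, hV'⟩ := mem_reducedBy_iff.mp hV
  obtain ⟨hW, hW'⟩ := mem_reducedBy_iff.mp hW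
  exact mem_reducedBy_iff.mpr
    ⟨fun x hx => ⟨hV x hx.1, hW x hx.2⟩, fun x hx => ⟨hV' x hx.1, hW' x hx.2⟩⟩

theorem mem_reducedBy_ker {R T : E →L[ℂ] E} (h : R ∈ StarSubalgebra.centralizer ℂ {T})
    [R.ker.HasOrthogonalProjection] : T ∈ reducedBy R.ker := by
  obtain ⟨hT, hT'⟩ := (StarSubalgebra.mem_centralizer_iff ℂ).mp h T rfl
  refine mem_reducedBy_iff.mpr ⟨fun x hx => ?_, fun x hx => ?_⟩ <;>
    rw [LinearMap.mem_ker, ContinuousLinearMap.coe_coe] at hx ⊢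
  · calc R (T x) = T (R x) := (DFunLike.congr_fun hT x).symm
      _ = 0 := by rw [hx, map_zero]
  · calc R (star T x) = star T (R x) := (DFunLike.congr_fun hT' x).symm
      _ = 0 := by rw [hx, map_zero]

theorem inner_star_apply_right (T : E →L[ℂ] E) (x y : E) : ⟪x, star T y⟫_ℂ = ⟪T x, y⟫_ℂ :=
  T.adjoint_inner_right x y

/-- Every operator in `C` compresses to a scalar multiple of the identity on `U`. -/
def ScalarOn (C : StarSubalgebra ℂ (E →L[ℂ] E)) (U : Submodule ℂ E) : Prop :=
  ∀ c ∈ C, ∃ ω : ℂ, ∀ u ∈ U, ∀ v ∈ U, ⟪u, c v⟫_ℂ = ω * ⟪u, v⟫_ℂ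

theorem ScalarOn.inner_apply_apply {C : StarSubalgebra ℂ (E →L[ℂ] E)} {U : Submodule ℂ E}
    (h : ScalarOn C U) {a b : E →L[ℂ] E} (ha : a ∈ C) (hb : b ∈ C) {e u v : E} (he : e ∈ U)
    (he1 : ‖e‖ = 1) (hu : u ∈ U) (hv : v ∈ U) : ⟪a u, b v⟫_ℂ = ⟪a e, b e⟫_ℂ * ⟪u, v⟫_ℂ := by
  obtain ⟨ω, hω⟩ := h (star a * b) (mul_mem (star_mem ha) hb)
  have hpair : ∀ x ∈ U, ∀ y ∈ U, ⟪a x, b y⟫_ℂ = ω * ⟪x, y⟫_ℂ := fun x hx y hy =>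
    (inner_star_apply_right a x (b y)).symm.trans (hω x hx y hy)
  rw [hpair u hu v hv, hpair e he e he, inner_self_eq_norm_sq_to_K, he1]
  simp

theorem scalarOn_of_minimal [FiniteDimensional ℂ E] {T : E →L[ℂ] E} {U : Submodule ℂ E}
    (hU : Minimal (fun W : Submodule ℂ E => W ≠ ⊥ ∧ T ∈ reducedBy W) U) :
    ScalarOn (StarSubalgebra.centralizer ℂ {T}) U := by
  intro c hc
  have : Nontrivial U := Submodule.nontrivial_iff_ne_bot.mpr hU.1.1
  obtain ⟨ω, hω⟩ := Module.End.exists_eigenvalue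
    ((U.orthogonalProjectionOnto ∘L c ∘L U.subtypeL : U →L[ℂ] U) : U →ₗ[ℂ] U)
  obtain ⟨e, he, he0⟩ := hω.exists_hasEigenvector
  rw [Module.End.mem_eigenspace_iff] at he
  let R : E →L[ℂ] E := U.starProjection * (c - algebraMap ℂ _ ω)
  have hP : U.starProjection ∈ StarSubalgebra.centralizer ℂ {T} := by
    rw [StarSubalgebra.mem_centralizer_iff]
    rintro _ rfl
    exact ⟨(mem_reducedBy_iff_commute.mp hU.1.2).symm,
      (mem_reducedBy_iff_commute.mp (star_mem hU.1.2)).symm⟩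
  have hR : R ∈ StarSubalgebra.centralizer ℂ {T} := mul_mem hP (sub_mem hc (algebraMap_mem _ ω))
  have heR : R e = 0 := by
    have he' : U.starProjection (c e) = ω • (e : E) := congrArg Subtype.val he
    simp [R, Algebra.algebraMap_eq_smul_one, he']
  have hle : U ≤ U ⊓ R.ker :=
    hU.2 ⟨(Submodule.ne_bot_iff _).mpr ⟨e, ⟨e.2, heR⟩, by simpa using he0⟩,
      reducedBy_inf_le _ _ ⟨hU.1.2, mem_reducedBy_ker hR⟩⟩ inf_le_left
  refine ⟨ω, fun u hu v hv => ?_⟩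
  have hRv : U.starProjection (c v - ω • v) = 0 := (hle hv).2
  rw [Submodule.starProjection_apply_eq_zero_iff] at hRv
  rw [← inner_smul_right, ← sub_eq_zero, ← inner_sub_right, hRv u hu]

/-- The span `C • U` of the vectors `c u` with `c ∈ C` and `u ∈ U`. -/
noncomputable def orbitSpan (C : StarSubalgebra ℂ (E →L[ℂ] E)) (U : Submodule ℂ E) :
    Submodule ℂ E :=
  Submodule.map₂ (ContinuousLinearMap.coeLM ℂ) (Subalgebra.toSubmodule C.toSubalgebra) U

theorem apply_mem_orbitSpan {C : StarSubalgebra ℂ (E →L[ℂ] E)} {U : Submodule ℂ E}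
    {c : E →L[ℂ] E} (hc : c ∈ C) {u : E} (hu : u ∈ U) : c u ∈ orbitSpan C U :=
  Submodule.apply_mem_map₂ (ContinuousLinearMap.coeLM ℂ) hc hu

theorem orbitSpan_le {C : StarSubalgebra ℂ (E →L[ℂ] E)} {U W : Submodule ℂ E} :
    orbitSpan C U ≤ W ↔ ∀ c ∈ C, ∀ u ∈ U, c u ∈ W :=
  Submodule.map₂_le

theorem le_orbitSpan (C : StarSubalgebra ℂ (E →L[ℂ] E)) (U : Submodule ℂ E) :
    U ≤ orbitSpan C U := fun _ hu => apply_mem_orbitSpan (one_mem C) hu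

theorem le_reducedBy_orbitSpan (C : StarSubalgebra ℂ (E →L[ℂ] E)) (U : Submodule ℂ E)
    [(orbitSpan C U).HasOrthogonalProjection] : C ≤ reducedBy (orbitSpan C U) := by
  have hinv : ∀ a ∈ C, orbitSpan C U ≤ (orbitSpan C U).comap (a : E →ₗ[ℂ] E) := fun a ha =>
    orbitSpan_le.mpr fun c hc u hu => apply_mem_orbitSpan (mul_mem ha hc) hu
  exact fun a ha => mem_reducedBy_iff.mpr ⟨hinv a ha, hinv (star a) (star_mem ha)⟩

theorem mem_reducedBy_orbitSpan {C : StarSubalgebra ℂ (E →L[ℂ] E)} {U : Submodule ℂ E}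
    [U.HasOrthogonalProjection] [(orbitSpan C U).HasOrthogonalProjection] {T : E →L[ℂ] E}
    (hC : C ≤ StarSubalgebra.centralizer ℂ {T}) (hT : T ∈ reducedBy U) :
    T ∈ reducedBy (orbitSpan C U) := by
  have hcomm : ∀ c ∈ C, T * c = c * T ∧ star T * c = c * star T := fun c hc =>
    (StarSubalgebra.mem_centralizer_iff ℂ).mp (hC hc) T rfl
  have hinv : ∀ S ∈ reducedBy U, (∀ c ∈ C, S * c = c * S) →
      orbitSpan C U ≤ (orbitSpan C U).comap (S : E →ₗ[ℂ] E) := fun S hS hSC =>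
    orbitSpan_le.mpr fun c hc u hu => by
      have hSu : S (c u) = c (S u) := DFunLike.congr_fun (hSC c hc) u
      rw [Submodule.mem_comap, ContinuousLinearMap.coe_coe, hSu]
      exact apply_mem_orbitSpan hc (apply_mem_of_mem_reducedBy hS hu)
  exact mem_reducedBy_iff.mpr
    ⟨hinv T hT fun c hc => (hcomm c hc).1, hinv _ (star_mem hT) fun c hc => (hcomm c hc).2⟩

theorem mem_orbitSpan_span_singleton {C : StarSubalgebra ℂ (E →L[ℂ] E)} {e x : E} :
    x ∈ orbitSpan C (ℂ ∙ e) ↔ ∃ c ∈ C, c e = x := by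
  rw [orbitSpan, Submodule.map₂_span_singleton_eq_map_flip, Submodule.mem_map]
  rfl

theorem exists_sum_eq_of_mem_orbitSpan {C : StarSubalgebra ℂ (E →L[ℂ] E)} {U : Submodule ℂ E}
    {κ : Type*} [Fintype κ] (b : OrthonormalBasis κ ℂ U) {x : E} (hx : x ∈ orbitSpan C U) :
    ∃ c : κ → E →L[ℂ] E, (∀ i, c i ∈ C) ∧ ∑ i, c i (b i) = x := by
  let L : (κ → Subalgebra.toSubmodule C.toSubalgebra) →ₗ[ℂ] E :=
    ∑ i, ((ContinuousLinearMap.coeLM ℂ).flip (b i : E)).domRestrict _ ∘ₗ LinearMap.proj i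
  have hL : ∀ c, L c = ∑ i, (c i : E →L[ℂ] E) (b i) := fun c => by simp [L]
  have hle : orbitSpan C U ≤ L.range := orbitSpan_le.mpr fun c hc u hu => by
    refine ⟨fun i => ⟨⟪b i, (⟨u, hu⟩ : U)⟫_ℂ • c, C.smul_mem hc _⟩, ?_⟩
    have hsum := congrArg (fun v : U => c v) (b.sum_repr' ⟨u, hu⟩)
    simpa only [hL, Submodule.coe_sum, map_sum, Submodule.coe_smul, map_smul, smul_apply] using hsum
  obtain ⟨c, rfl⟩ := hle hx
  exact ⟨fun i => c i, fun i => (c i).2, (hL c).symm⟩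

end Reducing

section OrbitSpan

variable {E : Type*} [NormedAddCommGroup E] [InnerProductSpace ℂ E] [CompleteSpace E]
  {C : StarSubalgebra ℂ (E →L[ℂ] E)} {U : Submodule ℂ E} {e : E}

theorem ScalarOn.inner_sum_apply_of_mem (h : ScalarOn C U) (he : e ∈ U) (he1 : ‖e‖ = 1)
    {κ : Type*} [Fintype κ] (b : OrthonormalBasis κ ℂ U) {c : κ → E →L[ℂ] E} (hc : ∀ i, c i ∈ C)
    {a : E →L[ℂ] E} (ha : a ∈ C) :
    ⟪∑ i, c i (b i), a (∑ i, c i (b i))⟫_ℂ = ∑ i, ⟪c i e, a (c i e)⟫_ℂ := by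
  classical
  have hpair : ∀ k i, ⟪c k (b k), a (c i (b i))⟫_ℂ =
      ⟪c k e, a (c i e)⟫_ℂ * if k = i then 1 else 0 := fun k i => by
    rw [← orthonormal_iff_ite.mp b.orthonormal k i, Submodule.coe_inner]
    exact h.inner_apply_apply (hc k) (mul_mem ha (hc i)) he he1 (b k).2 (b i).2
  simp [hpair]

theorem ScalarOn.inner_sum_apply_of_commute (h : ScalarOn C U) (he : e ∈ U) (he1 : ‖e‖ = 1)
    {κ μ : Type*} [Fintype κ] [Fintype μ] {b : κ → E} (hb : ∀ i, b i ∈ U)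
    (f : OrthonormalBasis μ ℂ E) {c : κ → E →L[ℂ] E} (hc : ∀ i, c i ∈ C) {T : E →L[ℂ] E}
    (hTU : ∀ u ∈ U, T u ∈ U) (hTc : ∀ i, Commute T (c i)) :
    ⟪∑ i, c i (b i), T (∑ i, c i (b i))⟫_ℂ =
      ∑ m, ⟪∑ i, ⟪f m, c i e⟫_ℂ • b i, T (∑ i, ⟪f m, c i e⟫_ℂ • b i)⟫_ℂ := by
  have hTc' : ∀ i v, T (c i v) = c i (T v) := fun i v => DFunLike.congr_fun (hTc i) v
  have hpair : ∀ k i, ⟪c k (b k), T (c i (b i))⟫_ℂ =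
      ∑ m, ⟪c k e, f m⟫_ℂ * (⟪f m, c i e⟫_ℂ * ⟪b k, T (b i)⟫_ℂ) := fun k i => by
    rw [hTc', h.inner_apply_apply (hc k) (hc i) he he1 (hb k) (hTU _ (hb i)),
      ← f.sum_inner_mul_inner, Finset.sum_mul]
    simp only [mul_assoc]
  simp only [map_sum, sum_inner, inner_sum, map_smul, inner_smul_left, inner_smul_right, hpair,
    inner_conj_symm, Finset.mul_sum]
  rw [Finset.sum_comm (γ := μ)]
  refine Finset.sum_congr rfl fun k _ => ?_
  rw [Finset.sum_comm]
  exact Finset.sum_congr rfl fun i _ => Finset.sum_congr rfl fun m _ => by ring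

/-- `C • U` behaves like the tensor product of `C e` and `U`: the vectors `p` and `v` stand for the
two partial traces of `x`, which additivity turns from mixed into pure states. -/
theorem ScalarOn.exists_inner_apply_eq [FiniteDimensional ℂ E] (h : ScalarOn C U) (he : e ∈ U)
    (he1 : ‖e‖ = 1) {𝒮 𝒯 : Set (E →L[ℂ] E)} (h𝒮C : 𝒮 ⊆ C) (h𝒯U : 𝒯 ⊆ reducedBy U)
    (h𝒯C : C ≤ StarSubalgebra.centralizer ℂ 𝒯) (h𝒮 : QuadAdditive 𝒮 (orbitSpan C (ℂ ∙ e)))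
    (h𝒯 : QuadAdditive 𝒯 U) {x : E} (hx : x ∈ orbitSpan C U) :
    ∃ p ∈ orbitSpan C (ℂ ∙ e), ∃ v ∈ U, (∀ S ∈ 𝒮, ⟪p, S p⟫_ℂ = ⟪x, S x⟫_ℂ) ∧
      ∀ T ∈ 𝒯, ⟪v, T v⟫_ℂ = ⟪x, T x⟫_ℂ := by
  let b := stdOrthonormalBasis ℂ U
  let f := stdOrthonormalBasis ℂ E
  obtain ⟨c, hc, rfl⟩ := exists_sum_eq_of_mem_orbitSpan b hx
  obtain ⟨p, hp, hpS⟩ := h𝒮.exists_sum Finset.univ (x := fun i => c i e) fun i =>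
    mem_orbitSpan_span_singleton.mpr ⟨c i, hc i, rfl⟩
  obtain ⟨v, hv, hvT⟩ := h𝒯.exists_sum Finset.univ
    (x := fun m => ∑ i, ⟪f m, c i e⟫_ℂ • (b i : E)) fun m =>
      U.sum_mem fun i _ => U.smul_mem _ (b i).2
  refine ⟨p, hp, v, hv, fun S hS => ?_, fun T hT => ?_⟩
  · rw [hpS S hS, h.inner_sum_apply_of_mem he he1 b hc (h𝒮C hS)]
  · rw [hvT T hT, h.inner_sum_apply_of_commute he he1 (fun i => (b i).2) f hc
      (fun u => apply_mem_of_mem_reducedBy (h𝒯U hT))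
      fun i => ((StarSubalgebra.mem_centralizer_iff ℂ).mp (h𝒯C (hc i)) T hT).1]

theorem ScalarOn.exists_mem_orbitSpan_inner_apply_eq (h : ScalarOn C U) (he : e ∈ U)
    (he1 : ‖e‖ = 1) {c : E →L[ℂ] E} (hc : c ∈ C) {u : E} (hu : u ∈ U) (hcu : ‖c e‖ = ‖u‖) :
    ∃ w ∈ orbitSpan C U, (∀ a ∈ C, ⟪w, a w⟫_ℂ = ⟪c e, a (c e)⟫_ℂ) ∧
      ∀ T : E →L[ℂ] E, (∀ v ∈ U, T v ∈ U) → Commute T c → ⟪w, T w⟫_ℂ = ⟪u, T u⟫_ℂ := by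
  rcases eq_or_ne u 0 with rfl | hu0
  · have hce : c e = 0 := by simpa using hcu
    exact ⟨0, Submodule.zero_mem _, by simp [hce], by simp⟩
  have hinv : ((‖u‖⁻¹ : ℝ) : ℂ) ^ 2 * ⟪u, u⟫_ℂ = 1 := by
    have hu0' : (‖u‖ : ℂ) ≠ 0 := by simpa using hu0
    simp [hu0']
  refine ⟨((‖u‖⁻¹ : ℝ) : ℂ) • c u, Submodule.smul_mem _ _ (apply_mem_orbitSpan hc hu),
    fun a ha => ?_, fun T hTU hTc => ?_⟩ <;> rw [inner_ofReal_smul_apply]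
  · have hac : ⟪c u, a (c u)⟫_ℂ = ⟪c e, a (c e)⟫_ℂ * ⟪u, u⟫_ℂ :=
      h.inner_apply_apply hc (mul_mem ha hc) he he1 hu hu
    rw [hac, mul_left_comm, hinv, mul_one]
  · have hTc' : T (c u) = c (T u) := DFunLike.congr_fun hTc u
    have hce : ⟪c e, c e⟫_ℂ = ⟪u, u⟫_ℂ := by
      rw [inner_self_eq_norm_sq_to_K, inner_self_eq_norm_sq_to_K, hcu]
    rw [hTc', h.inner_apply_apply hc hc he he1 hu (hTU u hu), hce, ← mul_assoc, hinv, one_mul]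

theorem ScalarOn.quadAdditive_orbitSpan [FiniteDimensional ℂ E] (h : ScalarOn C U) (he : e ∈ U)
    (he1 : ‖e‖ = 1) {𝒮 𝒯 : Set (E →L[ℂ] E)} (h𝒮1 : 1 ∈ 𝒮) (h𝒯1 : 1 ∈ 𝒯) (h𝒮C : 𝒮 ⊆ C)
    (h𝒯U : 𝒯 ⊆ reducedBy U) (h𝒯C : C ≤ StarSubalgebra.centralizer ℂ 𝒯)
    (h𝒮 : QuadAdditive 𝒮 (orbitSpan C (ℂ ∙ e))) (h𝒯 : QuadAdditive 𝒯 U) :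
    QuadAdditive (𝒮 ∪ 𝒯) (orbitSpan C U) := by
  intro x hx y hy
  obtain ⟨p, hp, v, hv, hpx, hvx⟩ := h.exists_inner_apply_eq he he1 h𝒮C h𝒯U h𝒯C h𝒮 h𝒯 hx
  obtain ⟨q, hq, v', hv', hqy, hvy⟩ := h.exists_inner_apply_eq he he1 h𝒮C h𝒯U h𝒯C h𝒮 h𝒯 hy
  obtain ⟨r, hr, hrS⟩ := h𝒮 p hp q hq
  obtain ⟨u, hu, huT⟩ := h𝒯 v hv v' hv'
  obtain ⟨c, hc, rfl⟩ := mem_orbitSpan_span_singleton.mp hr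
  have hself : ⟪c e, c e⟫_ℂ = ⟪u, u⟫_ℂ :=
    calc ⟪c e, c e⟫_ℂ = ⟪x, x⟫_ℂ + ⟪y, y⟫_ℂ :=
          (hrS 1 h𝒮1).trans (congrArg₂ (· + ·) (hpx 1 h𝒮1) (hqy 1 h𝒮1))
      _ = ⟪u, u⟫_ℂ := ((huT 1 h𝒯1).trans (congrArg₂ (· + ·) (hvx 1 h𝒯1) (hvy 1 h𝒯1))).symm
  have hnorm : ‖c e‖ = ‖u‖ := by
    rw [norm_eq_sqrt_re_inner (𝕜 := ℂ) (c e), norm_eq_sqrt_re_inner (𝕜 := ℂ) u, hself]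
  obtain ⟨w, hw, hwC, hwT⟩ := h.exists_mem_orbitSpan_inner_apply_eq he he1 hc hu hnorm
  refine ⟨w, hw, ?_⟩
  rintro S (hS | hS)
  · rw [hwC S (h𝒮C hS), hrS S hS, hpx S hS, hqy S hS]
  · rw [hwT S (fun v => apply_mem_of_mem_reducedBy (h𝒯U hS))
      ((StarSubalgebra.mem_centralizer_iff ℂ).mp (h𝒯C hc) S hS).1, huT S hS, hvx S hS, hvy S hS]

end OrbitSpan

section OrthogonalSum

variable {E : Type*} [NormedAddCommGroup E] [InnerProductSpace ℂ E] [CompleteSpace E]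
  {𝒮 : Set (E →L[ℂ] E)}

theorem inner_add_apply_add_of_mem_orthogonal {W : Submodule ℂ E} [W.HasOrthogonalProjection]
    {T : E →L[ℂ] E} (hT : T ∈ reducedBy W) {p q : E} (hp : p ∈ W) (hq : q ∈ Wᗮ) :
    ⟪p + q, T (p + q)⟫_ℂ = ⟪p, T p⟫_ℂ + ⟪q, T q⟫_ℂ := by
  have hTp : T p ∈ W := apply_mem_of_mem_reducedBy hT hp
  have hTq : T q ∈ Wᗮ := apply_mem_of_mem_reducedBy (reducedBy_orthogonal W ▸ hT) hq
  rw [map_add, inner_add_left, inner_add_right, inner_add_right,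
    Submodule.inner_right_of_mem_orthogonal hp hTq, Submodule.inner_left_of_mem_orthogonal hTp hq,
    add_zero, zero_add]

theorem QuadAdditive.of_orthogonal {V W : Submodule ℂ E} [W.HasOrthogonalProjection]
    (hWV : W ≤ V) (h𝒮 : 𝒮 ⊆ reducedBy W) (hW : QuadAdditive 𝒮 W)
    (hW' : QuadAdditive 𝒮 (V ⊓ Wᗮ)) : QuadAdditive 𝒮 V := by
  have hsplit : ∀ x ∈ V, ∃ p ∈ W, ∃ q ∈ V ⊓ Wᗮ, x = p + q := fun x hx =>
    ⟨_, W.starProjection_apply_mem x, x - W.starProjection x,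
      ⟨V.sub_mem hx (hWV (W.starProjection_apply_mem x)), W.sub_starProjection_mem_orthogonal x⟩,
      (add_sub_cancel _ _).symm⟩
  intro x hx y hy
  obtain ⟨p, hp, q, hq, rfl⟩ := hsplit x hx
  obtain ⟨p', hp', q', hq', rfl⟩ := hsplit y hy
  obtain ⟨w, hw, hwS⟩ := hW p hp p' hp'
  obtain ⟨w', hw', hwS'⟩ := hW' q hq q' hq'
  refine ⟨w + w', V.add_mem (hWV hw) hw'.1, fun S hS => ?_⟩
  rw [inner_add_apply_add_of_mem_orthogonal (h𝒮 hS) hw hw'.2,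
    inner_add_apply_add_of_mem_orthogonal (h𝒮 hS) hp hq.2,
    inner_add_apply_add_of_mem_orthogonal (h𝒮 hS) hp' hq'.2, hwS S hS, hwS' S hS]
  ring

theorem quadAdditive_of_forall_exists_le [FiniteDimensional ℂ E]
    (h : ∀ V : Submodule ℂ E, V ≠ ⊥ → 𝒮 ⊆ reducedBy V →
      ∃ W ≤ V, W ≠ ⊥ ∧ 𝒮 ⊆ reducedBy W ∧ QuadAdditive 𝒮 W)
    {V : Submodule ℂ E} (hV : 𝒮 ⊆ reducedBy V) : QuadAdditive 𝒮 V := by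
  induction V using WellFoundedLT.induction with
  | ind V ih =>
  rcases eq_or_ne V ⊥ with rfl | hV0
  · simp [QuadAdditive]
  obtain ⟨W, hWV, hW0, h𝒮W, hW⟩ := h V hV0 hV
  refine hW.of_orthogonal hWV h𝒮W (ih _ (inf_lt_left.mpr fun hle => ?_) fun S hS => ?_)
  · exact hW0 (W.orthogonal_disjoint.eq_bot_of_le (hWV.trans hle))
  · exact reducedBy_inf_le _ _ ⟨hV hS, reducedBy_orthogonal W ▸ h𝒮W hS⟩

end OrthogonalSum

section DoublyCommute

variable {E : Type*} [NormedAddCommGroup E] [InnerProductSpace ℂ E] [CompleteSpace E]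

/-- `S` and `T` doubly commute: `T` commutes with both `S` and its adjoint. -/
def DoublyCommute (S T : E →L[ℂ] E) : Prop :=
  Commute S T ∧ Commute (star S) T

theorem DoublyCommute.symm {S T : E →L[ℂ] E} (h : DoublyCommute S T) : DoublyCommute T S :=
  ⟨h.1.symm, by simpa using h.2.symm.star_star⟩

theorem mem_centralizer_singleton {S T : E →L[ℂ] E} :
    T ∈ StarSubalgebra.centralizer ℂ {S} ↔ DoublyCommute S T := by
  simp [StarSubalgebra.mem_centralizer_iff, DoublyCommute, Commute, SemiconjBy]

theorem exists_quadAdditive_le [FiniteDimensional ℂ E] {𝒮 : Set (E →L[ℂ] E)} {T : E →L[ℂ] E}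
    (h𝒮T : ∀ S ∈ 𝒮, DoublyCommute T S)
    (h𝒮 : ∀ V : Submodule ℂ E, 𝒮 ⊆ reducedBy V → QuadAdditive (insert 1 𝒮) V)
    {V : Submodule ℂ E} (hV0 : V ≠ ⊥) (hV : insert T 𝒮 ⊆ reducedBy V) :
    ∃ W ≤ V, W ≠ ⊥ ∧ insert T 𝒮 ⊆ reducedBy W ∧ QuadAdditive (insert 1 (insert T 𝒮)) W := by
  obtain ⟨hTV, h𝒮V⟩ := Set.insert_subset_iff.mp hV
  obtain ⟨U, hUV, hU⟩ := exists_minimal_le_of_wellFoundedLT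
    (fun W : Submodule ℂ E => W ≠ ⊥ ∧ T ∈ reducedBy W) V ⟨hV0, hTV⟩
  let C := reducedBy V ⊓ StarSubalgebra.centralizer ℂ {T}
  have hCT : C ≤ StarSubalgebra.centralizer ℂ {T} := inf_le_right
  have h𝒮C : 𝒮 ⊆ C := fun S hS => ⟨h𝒮V hS, mem_centralizer_singleton.mpr (h𝒮T S hS)⟩
  have hscalar : ScalarOn C U := fun c hc => scalarOn_of_minimal hU c (hCT hc)
  obtain ⟨e, he, he1⟩ : ∃ e ∈ U, ‖e‖ = 1 := by
    have : Nontrivial U := Submodule.nontrivial_iff_ne_bot.mpr hU.1.1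
    obtain ⟨e, he⟩ := exists_norm_eq U zero_le_one
    exact ⟨e, e.2, he⟩
  refine ⟨orbitSpan C U, orbitSpan_le.mpr fun c hc u hu => apply_mem_of_mem_reducedBy hc.1 (hUV hu),
    ne_bot_of_le_ne_bot hU.1.1 (le_orbitSpan C U),
    Set.insert_subset (mem_reducedBy_orbitSpan hCT hU.1.2)
      (h𝒮C.trans (le_reducedBy_orbitSpan C U)), ?_⟩
  have hunion : insert 1 (insert T 𝒮) = insert 1 𝒮 ∪ {1, T} := by
    ext S
    simp only [Set.mem_insert_iff, Set.mem_union, Set.mem_singleton_iff]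
    tauto
  have hC1T : C ≤ StarSubalgebra.centralizer ℂ {1, T} := fun c hc =>
    (StarSubalgebra.mem_centralizer_iff ℂ).mpr <| Set.forall_mem_insert.mpr
      ⟨by simp, (StarSubalgebra.mem_centralizer_iff ℂ).mp (hCT hc)⟩
  rw [hunion]
  exact hscalar.quadAdditive_orbitSpan he he1 (Set.mem_insert 1 𝒮) (Set.mem_insert 1 {T})
    (Set.insert_subset (one_mem C) h𝒮C)
    (Set.insert_subset (one_mem _) (Set.singleton_subset_iff.mpr hU.1.2)) hC1T
    (h𝒮 _ (h𝒮C.trans (le_reducedBy_orbitSpan C _))) (quadAdditive_pair_one T U)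

theorem quadAdditive_of_pairwise_doublyCommute [FiniteDimensional ℂ E] {𝒮 : Set (E →L[ℂ] E)}
    (hfin : 𝒮.Finite) (hcomm : 𝒮.Pairwise DoublyCommute) {V : Submodule ℂ E}
    (hV : 𝒮 ⊆ reducedBy V) : QuadAdditive (insert 1 𝒮) V := by
  induction 𝒮, hfin using Set.Finite.induction_on generalizing V with
  | empty => simpa using quadAdditive_pair_one 1 V
  | @insert T 𝒮 hT _ ih =>
  obtain ⟨hcomm𝒮, h𝒮T⟩ := (Set.pairwise_insert_of_notMem hT).mp hcomm
  refine quadAdditive_of_forall_exists_le (fun V hV0 hV => ?_)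
    (Set.insert_subset (one_mem _) hV)
  obtain ⟨W, hWV, hW0, hW, hadd⟩ := exists_quadAdditive_le (fun S hS => (h𝒮T S hS).1)
    (fun V hV => ih hcomm𝒮 hV) hV0 ((Set.subset_insert _ _).trans hV)
  exact ⟨W, hWV, hW0, Set.insert_subset (one_mem _) hW, hadd⟩

end DoublyCommute

section Commutator

variable {E : Type*} [NormedAddCommGroup E] [InnerProductSpace ℂ E] [CompleteSpace E]

theorem DoublyCommute.of_mem_adjoin {S T S' T' : E →L[ℂ] E} (h : DoublyCommute S T)
    (hS : S' ∈ StarAlgebra.adjoin ℂ {S}) (hT : T' ∈ StarAlgebra.adjoin ℂ {T}) :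
    DoublyCommute S' T' := by
  have hright : ∀ {X Y Y' : E →L[ℂ] E}, DoublyCommute X Y → Y' ∈ StarAlgebra.adjoin ℂ {Y} →
      DoublyCommute X Y' := fun {X Y Y'} hXY hY' => mem_centralizer_singleton.mp <|
    StarAlgebra.adjoin_le (Set.singleton_subset_iff.mpr (mem_centralizer_singleton.mpr hXY)) hY'
  exact (hright (hright h hT).symm hS).symm

variable [FiniteDimensional ℂ E]

theorem eq_zero_of_trace_star_mul_self_eq_zero {D : E →L[ℂ] E}
    (h : LinearMap.trace ℂ E (star D * D : E →L[ℂ] E) = 0) : D = 0 := by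
  let b := stdOrthonormalBasis ℂ E
  have hsum : ∑ i, ‖D (b i)‖ ^ 2 = 0 := by
    rw [LinearMap.trace_eq_sum_inner _ b] at h
    have hterm : ∀ i, ⟪b i, (star D * D) (b i)⟫_ℂ = ((‖D (b i)‖ ^ 2 : ℝ) : ℂ) := fun i => by
      rw [mul_apply_eq_comp, inner_star_apply_right, inner_self_eq_norm_sq_to_K]
      simp
    simp only [ContinuousLinearMap.coe_coe, hterm] at h
    exact_mod_cast h
  refine ContinuousLinearMap.coe_injective (b.toBasis.ext fun i => ?_)
  simpa using (Finset.sum_eq_zero_iff_of_nonneg fun i _ => by positivity).mp hsum i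

theorem commutator_eq_zero_of_commute {S C : E →L[ℂ] E} (hS : IsSelfAdjoint S)
    (h : Commute S (S * C - C * S)) : S * C - C * S = 0 := by
  set D := S * C - C * S with hD
  have hcomm : Commute S (star D) := by simpa [hS.star_eq] using h.star_star
  refine eq_zero_of_trace_star_mul_self_eq_zero ?_
  have hDD : star D * D = S * (star D * C) - (star D * C) * S := by
    rw [← mul_assoc, hcomm.eq, mul_assoc, mul_assoc, ← mul_sub, ← hD]
  rw [hDD, ContinuousLinearMap.toLinearMap_sub, map_sub, sub_eq_zero]
  exact LinearMap.trace_mul_comm ℂ _ _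

/-- The kernel and range of `C ↦ S * C - C * S` meet trivially, hence span `N`. -/
theorem exists_commute_add_commutator_eq {N : Subalgebra ℂ (E →L[ℂ] E)} {S : E →L[ℂ] E}
    (hS : IsSelfAdjoint S) (hSN : S ∈ N) {A : E →L[ℂ] E} (hA : A ∈ N) :
    ∃ B ∈ N, ∃ C ∈ N, Commute S B ∧ B + (S * C - C * S) = A := by
  let δ : N →ₗ[ℂ] N := LinearMap.mulLeft ℂ ⟨S, hSN⟩ - LinearMap.mulRight ℂ ⟨S, hSN⟩
  have hdisj : Disjoint δ.range δ.ker := by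
    rw [Submodule.disjoint_def]
    rintro _ ⟨C, rfl⟩ hC
    have hC' : S * (δ C : E →L[ℂ] E) - δ C * S = 0 := congrArg Subtype.val hC
    exact Subtype.ext (commutator_eq_zero_of_commute hS (sub_eq_zero.mp hC'))
  have htop : δ.range ⊔ δ.ker = ⊤ :=
    Submodule.eq_top_of_disjoint _ _ δ.finrank_range_add_finrank_ker.ge hdisj
  obtain ⟨_, ⟨C, rfl⟩, B, hB, hsum⟩ :=
    Submodule.mem_sup.mp (htop ▸ Submodule.mem_top : (⟨A, hA⟩ : N) ∈ δ.range ⊔ δ.ker)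
  refine ⟨B, B.2, C, C.2, sub_eq_zero.mp (congrArg Subtype.val hB), ?_⟩
  rw [add_comm]
  exact congrArg Subtype.val hsum

end Commutator

section Eigenspace

variable {E : Type*} [NormedAddCommGroup E] [InnerProductSpace ℂ E] [CompleteSpace E]
  {ι : Type*} [Fintype ι]

theorem isSelfAdjoint_sum_star_mul_self (A : ι → E →L[ℂ] E) :
    IsSelfAdjoint (∑ i, star (A i) * A i) :=
  isSelfAdjoint_sum _ fun i _ => IsSelfAdjoint.star_mul_self (A i)

theorem inner_commutator_apply_of_apply_eq_smul {S : E →L[ℂ] E} (hS : IsSelfAdjoint S)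
    (C : E →L[ℂ] E) {l : ℝ} {x : E} (hx : S x = (l : ℂ) • x) :
    ⟪x, (S * C - C * S) x⟫_ℂ = 0 := by
  rw [sub_apply, mul_apply_eq_comp, mul_apply_eq_comp, inner_sub_right,
    ← hS.star_eq, inner_star_apply_right, hS.star_eq, hx, map_smul, inner_smul_left,
    inner_smul_right, Complex.conj_ofReal, sub_self]

theorem mem_reducedBy_eigenspace {S T : E →L[ℂ] E} (hS : IsSelfAdjoint S) (h : Commute S T)
    (l : ℂ) : T ∈ reducedBy (Module.End.eigenspace (S : E →ₗ[ℂ] E) l) := by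
  have hker : Module.End.eigenspace (S : E →ₗ[ℂ] E) l = (S - algebraMap ℂ _ l).ker := by
    rw [Module.End.eigenspace_def]
    rfl
  have hST : S ∈ StarSubalgebra.centralizer ℂ {T} :=
    mem_centralizer_singleton.mpr (DoublyCommute.symm ⟨h, by rwa [hS.star_eq]⟩)
  have hT := mem_reducedBy_iff.mp (mem_reducedBy_ker (sub_mem hST (algebraMap_mem _ l)))
  rw [← hker] at hT
  exact mem_reducedBy_iff.mpr hT

theorem exists_pairwise_doublyCommute_reducing [FiniteDimensional ℂ E] {A : ι → E →L[ℂ] E}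
    (hA : Pairwise fun i j => DoublyCommute (A i) (A j)) (l : ℝ) :
    ∃ B : ι → E →L[ℂ] E, (Pairwise fun i j => DoublyCommute (B i) (B j)) ∧
      ∀ j, B j ∈ reducedBy
          (Module.End.eigenspace ((∑ i, star (A i) * A i : E →L[ℂ] E) : E →ₗ[ℂ] E) (l : ℂ)) ∧
        ∀ x, (∑ i, star (A i) * A i) x = (l : ℂ) • x → ⟪x, A j x⟫_ℂ = ⟪x, B j x⟫_ℂ := by
  classical
  let N : ι → StarSubalgebra ℂ (E →L[ℂ] E) := fun i => StarAlgebra.adjoin ℂ {A i}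
  let S : ι → E →L[ℂ] E := fun i => star (A i) * A i
  have hAN : ∀ i, A i ∈ N i := fun i => StarAlgebra.self_mem_adjoin_singleton ℂ (A i)
  have hSN : ∀ i, S i ∈ N i := fun i => mul_mem (star_mem (hAN i)) (hAN i)
  have hNN : ∀ {i j X Y}, i ≠ j → X ∈ N i → Y ∈ N j → DoublyCommute X Y := fun hij =>
    (hA hij).of_mem_adjoin
  choose B hB C hC hSB hBC using fun j => exists_commute_add_commutator_eq
    (N := (N j).toSubalgebra) (IsSelfAdjoint.star_mul_self (A j)) (hSN j) (hAN j)
  have hS : IsSelfAdjoint (∑ i, S i) := isSelfAdjoint_sum_star_mul_self A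
  refine ⟨B, fun i j hij => hNN hij (hB i) (hB j), fun j => ⟨?_, fun x hx => ?_⟩⟩
  · refine mem_reducedBy_eigenspace hS (Commute.sum_left _ _ _ fun i _ => ?_) _
    rcases eq_or_ne i j with rfl | hij
    · exact hSB i
    · exact (hNN hij (hSN i) (hB j)).1
  · have hcomm : S j * C j - C j * S j = (∑ i, S i) * C j - C j * ∑ i, S i := by
      rw [Finset.sum_mul, Finset.mul_sum, ← Finset.sum_sub_distrib]
      exact (Finset.sum_eq_single j (fun i _ hij => sub_eq_zero.mpr (hNN hij (hSN i) (hC j)).1)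
        (by simp)).symm
    have hzero : ⟪x, (S j * C j - C j * S j) x⟫_ℂ = 0 :=
      hcomm ▸ inner_commutator_apply_of_apply_eq_smul hS (C j) hx
    rw [← hBC j, add_apply, inner_add_right, hzero, add_zero]

theorem quadAdditive_eigenspace_sum_star_mul_self [FiniteDimensional ℂ E] {A : ι → E →L[ℂ] E}
    (hA : Pairwise fun i j => DoublyCommute (A i) (A j)) (l : ℝ) :
    QuadAdditive (insert 1 (Set.range A))
      (Module.End.eigenspace ((∑ i, star (A i) * A i : E →L[ℂ] E) : E →ₗ[ℂ] E) (l : ℂ)) := by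
  obtain ⟨B, hB, hAB⟩ := exists_pairwise_doublyCommute_reducing hA l
  have hAB' : ∀ j, ∀ x ∈ Module.End.eigenspace
      ((∑ i, star (A i) * A i : E →L[ℂ] E) : E →ₗ[ℂ] E) (l : ℂ), ⟪x, A j x⟫_ℂ = ⟪x, B j x⟫_ℂ :=
    fun j x hx => (hAB j).2 x (Module.End.mem_eigenspace_iff.mp hx)
  intro x hx y hy
  obtain ⟨w, hw, hwB⟩ := quadAdditive_of_pairwise_doublyCommute (Set.finite_range B)
    hB.range_pairwise (Set.range_subset_iff.mpr fun j => (hAB j).1) x hx y hy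
  refine ⟨w, hw, Set.forall_mem_insert.mpr
    ⟨hwB 1 (Set.mem_insert _ _), Set.forall_mem_range.mpr fun j => ?_⟩⟩
  rw [hAB' j w hw, hAB' j x hx, hAB' j y hy]
  exact hwB (B j) (Set.mem_insert_of_mem _ (Set.mem_range_self j))

end Eigenspace

section FirstOrder

theorem exists_forall_re_inner_pos {F : Type*} [NormedAddCommGroup F] [InnerProductSpace ℂ F]
    [CompleteSpace F] {K : Set F} (hconv : Convex ℝ K) (hclosed : IsClosed K) (h0 : 0 ∉ K) :
    ∃ c : F, ∀ q ∈ K, 0 < (⟪c, q⟫_ℂ).re := by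
  obtain ⟨f, u, hu, hf⟩ := RCLike.geometric_hahn_banach_point_closed (𝕜 := ℂ) hconv hclosed h0
  refine ⟨(InnerProductSpace.toDual ℂ F).symm f, fun q hq => ?_⟩
  rw [InnerProductSpace.toDual_symm_apply]
  exact (by simpa using hu : 0 < u).trans (hf q hq)

theorem exists_eq_and_nonpos_of_forall_le_sub_mul_add {X : Type*} [TopologicalSpace X] {K : Set X}
    (hK : IsCompact K) {a b : X → ℝ} (ha : ContinuousOn a K) (hb : ContinuousOn b K) {M G : ℝ}
    (hM : ∀ x ∈ K, a x ≤ M) (h : ∀ ε > 0, ∃ x ∈ K, M ≤ a x - ε * b x + ε ^ 2 * G) :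
    ∃ x ∈ K, a x = M ∧ b x ≤ 0 := by
  obtain ⟨x₁, hx₁, -⟩ := h 1 one_pos
  obtain ⟨x₀, -, hx₀⟩ := hK.exists_isMinOn ⟨x₁, hx₁⟩ hb
  obtain ⟨y, hy, hmin⟩ := hK.exists_isMinOn ⟨x₁, hx₁⟩ ((continuousOn_const.sub ha).sup hb)
  have hbound : ∀ ε > 0, max (M - a y) (b y) ≤ max (ε * (ε * G - b x₀)) (ε * G) := fun ε hε => by
    obtain ⟨x, hx, hMx⟩ := h ε hε
    have hbx : b x ≤ ε * G := le_of_mul_le_mul_left (by nlinarith [hM x hx]) hε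
    have hax : M - a x ≤ ε * (ε * G - b x₀) := by
      nlinarith [mul_le_mul_of_nonneg_left (hx₀ hx) hε.le]
    exact (hmin hx).trans (max_le_max hax hbx)
  have hlim : Filter.Tendsto (fun ε => max (ε * (ε * G - b x₀)) (ε * G)) (nhdsWithin 0 (Set.Ioi 0))
      (nhds 0) := by
    have hcont : Continuous fun ε => max (ε * (ε * G - b x₀)) (ε * G) := by fun_prop
    simpa using (hcont.tendsto 0).mono_left nhdsWithin_le_nhds
  have hle : max (M - a y) (b y) ≤ 0 := ge_of_tendsto hlim (eventually_mem_nhdsWithin.mono hbound)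
  obtain ⟨hay, hby⟩ := max_le_iff.mp hle
  exact ⟨y, hy, le_antisymm (hM y hy) (sub_nonpos.mp hay), hby⟩

end FirstOrder

section Variance

variable {E : Type*} [NormedAddCommGroup E] [InnerProductSpace ℂ E] {ι : Type*}

/-- The vector of expectations `⟪x, A i x⟫`, as a point of Euclidean space. -/
noncomputable def expectation (A : ι → E →L[ℂ] E) (x : E) : EuclideanSpace ℂ ι :=
  WithLp.toLp 2 fun i => ⟪x, A i x⟫_ℂ

/-- The joint numerical range of `A` over the unit vectors of `V`. -/
def jointNumericalRange (A : ι → E →L[ℂ] E) (V : Submodule ℂ E) : Set (EuclideanSpace ℂ ι) :=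
  expectation A '' (Metric.sphere 0 1 ∩ V)

theorem continuous_expectation (A : ι → E →L[ℂ] E) : Continuous (expectation A) :=
  (PiLp.continuous_toLp 2 _).comp
    (continuous_pi fun i => continuous_id.inner (A i).continuous)

theorem isCompact_jointNumericalRange [FiniteDimensional ℂ E] (A : ι → E →L[ℂ] E)
    (V : Submodule ℂ E) : IsCompact (jointNumericalRange A V) := by
  have : ProperSpace E := FiniteDimensional.proper ℂ E
  exact ((isCompact_sphere 0 1).inter_right V.closed_of_finiteDimensional).image
    (continuous_expectation A)

theorem QuadAdditive.convex_jointNumericalRange {A : ι → E →L[ℂ] E} {V : Submodule ℂ E}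
    (h : QuadAdditive (insert 1 (Set.range A)) V) : Convex ℝ (jointNumericalRange A V) := by
  rintro _ ⟨x, ⟨hx1, hx⟩, rfl⟩ _ ⟨y, ⟨hy1, hy⟩, rfl⟩ a b ha hb hab
  obtain ⟨w, hw, hwS⟩ := h (((√a : ℝ) : ℂ) • x) (V.smul_mem _ hx) (((√b : ℝ) : ℂ) • y)
    (V.smul_mem _ hy)
  have hsq : ∀ {t : ℝ}, 0 ≤ t → ((√t : ℝ) : ℂ) ^ 2 = t := fun ht => by
    exact_mod_cast Real.sq_sqrt ht
  have hwS' : ∀ S ∈ insert 1 (Set.range A),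
      ⟪w, S w⟫_ℂ = (a : ℂ) * ⟪x, S x⟫_ℂ + (b : ℂ) * ⟪y, S y⟫_ℂ := fun S hS => by
    rw [hwS S hS, inner_ofReal_smul_apply, inner_ofReal_smul_apply, hsq ha, hsq hb]
  refine ⟨w, ⟨?_, hw⟩, ?_⟩
  · have hself := hwS' 1 (Set.mem_insert _ _)
    rw [mem_sphere_zero_iff_norm] at hx1 hy1
    simp only [one_apply_eq_self, inner_self_eq_norm_sq_to_K, hx1, hy1] at hself
    have hnorm : ‖w‖ ^ 2 = 1 := by
      rw [← hab]
      exact_mod_cast (by simpa using hself : (‖w‖ : ℂ) ^ 2 = a + b)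
    rw [mem_sphere_zero_iff_norm]
    exact (pow_eq_one_iff_of_nonneg (norm_nonneg w) two_ne_zero).mp hnorm
  · ext i
    simpa [expectation] using hwS' (A i) (Set.mem_insert_of_mem _ (Set.mem_range_self i))

theorem norm_sub_smul_sq {x : E} (hx : ‖x‖ = 1) (y : E) (z : ℂ) :
    ‖y - z • x‖ ^ 2 = ‖y‖ ^ 2 - ‖⟪x, y⟫_ℂ‖ ^ 2 + ‖z - ⟪x, y⟫_ℂ‖ ^ 2 := by
  have hinner : ⟪z, ⟪x, y⟫_ℂ⟫_ℂ = ⟪z • x, y⟫_ℂ := by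
    rw [inner_smul_left, RCLike.inner_apply, mul_comm]
  rw [norm_sub_sq (𝕜 := ℂ), norm_sub_sq (𝕜 := ℂ), hinner, inner_re_symm (z • x), norm_smul, hx]
  ring

variable [Fintype ι]

theorem sum_norm_sub_smul_sq (A : ι → E →L[ℂ] E) (z : EuclideanSpace ℂ ι) {x : E} (hx : ‖x‖ = 1) :
    ∑ i, ‖A i x - z i • x‖ ^ 2 =
      ∑ i, ‖A i x‖ ^ 2 - ‖expectation A x‖ ^ 2 + ‖z - expectation A x‖ ^ 2 := by
  simp only [EuclideanSpace.norm_sq_eq, ← Finset.sum_sub_distrib, ← Finset.sum_add_distrib,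
    norm_sub_smul_sq hx]
  rfl

variable [CompleteSpace E]

theorem inner_sum_star_mul_self_apply (A : ι → E →L[ℂ] E) (x : E) :
    ⟪x, (∑ i, star (A i) * A i) x⟫_ℂ = ((∑ i, ‖A i x‖ ^ 2 : ℝ) : ℂ) := by
  rw [sum_apply, inner_sum, Complex.ofReal_sum]
  refine Finset.sum_congr rfl fun i _ => ?_
  rw [mul_apply_eq_comp, inner_star_apply_right, inner_self_eq_norm_sq_to_K]
  simp

theorem sum_norm_apply_sq_of_mem_eigenspace (A : ι → E →L[ℂ] E) {M : ℝ} {x : E} (hx : ‖x‖ = 1)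
    (h : (∑ i, star (A i) * A i) x = (M : ℂ) • x) : ∑ i, ‖A i x‖ ^ 2 = M := by
  have hinner := inner_sum_star_mul_self_apply A x
  rw [h, inner_smul_right, inner_self_eq_norm_sq_to_K, hx] at hinner
  exact_mod_cast (by simpa using hinner.symm : ((∑ i, ‖A i x‖ ^ 2 : ℝ) : ℂ) = M)

theorem sum_star_mul_self_apply_of_isMaxOn (A : ι → E →L[ℂ] E) {x : E} (hx : ‖x‖ = 1)
    (hmax : IsMaxOn (fun y => ∑ i, ‖A i y‖ ^ 2) (Metric.sphere 0 1) x) :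
    (∑ i, star (A i) * A i) x = ((∑ i, ‖A i x‖ ^ 2 : ℝ) : ℂ) • x := by
  have hre : (∑ i, star (A i) * A i).reApplyInnerSelf = fun y => ∑ i, ‖A i y‖ ^ 2 := by
    ext y
    rw [ContinuousLinearMap.reApplyInnerSelf_apply, inner_re_symm, inner_sum_star_mul_self_apply]
    exact Complex.ofReal_re _
  have heig := (isSelfAdjoint_sum_star_mul_self A).eq_smul_self_of_isLocalExtrOn
    (x₀ := x) (Or.inr (by rw [hx, hre]; exact hmax.localize))
  simpa [ContinuousLinearMap.rayleighQuotient, hre, hx] using heig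

theorem exists_sum_norm_sq_eq_and_expectation_eq_zero [FiniteDimensional ℂ E]
    {A : ι → E →L[ℂ] E} (hA : Pairwise fun i j => DoublyCommute (A i) (A j)) {M : ℝ}
    (hM : ∀ x, ‖x‖ = 1 → ∑ i, ‖A i x‖ ^ 2 ≤ M)
    (hmin : ∀ z : EuclideanSpace ℂ ι, ∃ x, ‖x‖ = 1 ∧ M ≤ ∑ i, ‖A i x - z i • x‖ ^ 2) :
    ∃ x, ‖x‖ = 1 ∧ ∑ i, ‖A i x‖ ^ 2 = M ∧ expectation A x = 0 := by
  have : ProperSpace E := FiniteDimensional.proper ℂ E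
  let V := Module.End.eigenspace ((∑ i, star (A i) * A i : E →L[ℂ] E) : E →ₗ[ℂ] E) (M : ℂ)
  by_contra hne
  have h0 : 0 ∉ jointNumericalRange A V := by
    rintro ⟨x, ⟨hx1, hxV⟩, hx0⟩
    rw [mem_sphere_zero_iff_norm] at hx1
    exact hne ⟨x, hx1, sum_norm_apply_sq_of_mem_eigenspace A hx1
      (Module.End.mem_eigenspace_iff.mp hxV), hx0⟩
  obtain ⟨c, hc⟩ := exists_forall_re_inner_pos
    (quadAdditive_eigenspace_sum_star_mul_self hA M).convex_jointNumericalRange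
    (isCompact_jointNumericalRange A V).isClosed h0
  obtain ⟨x, hx1, hxM, hxc⟩ := exists_eq_and_nonpos_of_forall_le_sub_mul_add
    (isCompact_sphere (0 : E) 1) (a := fun x => ∑ i, ‖A i x‖ ^ 2)
    (b := fun x => 2 * (⟪c, expectation A x⟫_ℂ).re) (M := M) (G := ‖c‖ ^ 2) (by fun_prop)
    (by have := continuous_expectation A; fun_prop) (by simpa using hM) fun ε _ => by
      obtain ⟨x, hx, hMx⟩ := hmin ((ε : ℂ) • c)
      refine ⟨x, by simpa using hx, hMx.trans_eq ?_⟩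
      rw [sum_norm_sub_smul_sq A _ hx, norm_sub_sq (𝕜 := ℂ), norm_smul, mul_pow, inner_smul_left,
        Complex.conj_ofReal, Complex.norm_real, Real.norm_eq_abs, sq_abs, RCLike.re_eq_complex_re,
        Complex.re_ofReal_mul]
      ring
  rw [mem_sphere_zero_iff_norm] at hx1
  have hxV : x ∈ V := Module.End.mem_eigenspace_iff.mpr <| hxM ▸
    sum_star_mul_self_apply_of_isMaxOn A hx1 fun y hy => by
      simpa [hxM] using hM y (by simpa using hy)
  have hpos := hc _ ⟨x, ⟨by simpa using hx1, hxV⟩, rfl⟩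
  linarith

theorem exists_variance_eq_of_minimal [FiniteDimensional ℂ E]
    {A : ι → E →L[ℂ] E} (hA : Pairwise fun i j => DoublyCommute (A i) (A j)) {M : ℝ}
    {z : EuclideanSpace ℂ ι} (hM : ∀ x, ‖x‖ = 1 → ∑ i, ‖A i x - z i • x‖ ^ 2 ≤ M)
    (hmin : ∀ w : EuclideanSpace ℂ ι, ∃ x, ‖x‖ = 1 ∧ M ≤ ∑ i, ‖A i x - w i • x‖ ^ 2) :
    ∃ x, ‖x‖ = 1 ∧ ∑ i, ‖A i x‖ ^ 2 - ‖expectation A x‖ ^ 2 = M := by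
  let B : ι → E →L[ℂ] E := fun i => A i - algebraMap ℂ _ (z i)
  have hBA : ∀ i x, B i x = A i x - z i • x := fun i x => rfl
  have hB : Pairwise fun i j => DoublyCommute (B i) (B j) := fun i j hij =>
    have hmem : ∀ k, B k ∈ StarAlgebra.adjoin ℂ {A k} := fun k =>
      sub_mem (StarAlgebra.self_mem_adjoin_singleton ℂ _) (algebraMap_mem _ _)
    (hA hij).of_mem_adjoin (hmem i) (hmem j)
  obtain ⟨x, hx, hxM, hx0⟩ := exists_sum_norm_sq_eq_and_expectation_eq_zero hB hM fun w => by
    obtain ⟨x, hx, hMx⟩ := hmin (z + w)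
    refine ⟨x, hx, hMx.trans_eq (Finset.sum_congr rfl fun i _ => ?_)⟩
    rw [hBA, PiLp.add_apply, add_smul, sub_sub]
  have hz : z = expectation A x := by
    ext i
    have hi : ⟪x, B i x⟫_ℂ = 0 := congrArg (fun q => q i) hx0
    rw [hBA, inner_sub_right, inner_smul_right, inner_self_eq_norm_sq_to_K, hx] at hi
    simpa [expectation] using (sub_eq_zero.mp hi).symm
  refine ⟨x, hx, hxM ▸ ?_⟩
  simp only [hBA, sum_norm_sub_smul_sq A z hx, ← hz, sub_self, norm_zero]
  ring

end Variance

section Attainment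

theorem exists_forall_norm_sub_le {F G : Type*} [AddCommGroup F] [Module ℂ F]
    [NormedAddCommGroup G] [NormedSpace ℂ G] [FiniteDimensional ℂ G] (L : F →ₗ[ℂ] G) (y : G) :
    ∃ z, ∀ w, ‖y - L z‖ ≤ ‖y - L w‖ := by
  have : ProperSpace G := FiniteDimensional.proper ℂ G
  obtain ⟨_, ⟨z, rfl⟩, hz⟩ :=
    L.range.closed_of_finiteDimensional.exists_infDist_eq_dist L.range.nonempty y
  refine ⟨z, fun w => ?_⟩
  rw [← dist_eq_norm, ← dist_eq_norm, ← hz]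
  exact Metric.infDist_le_dist_of_mem ⟨w, rfl⟩

theorem exists_norm_apply_eq_opNorm {E F : Type*} [NormedAddCommGroup E] [NormedSpace ℂ E]
    [FiniteDimensional ℂ E] [Nontrivial E] [NormedAddCommGroup F] [NormedSpace ℂ F]
    (f : E →L[ℂ] F) : ∃ x, ‖x‖ = 1 ∧ ‖f x‖ = ‖f‖ := by
  have : ProperSpace E := FiniteDimensional.proper ℂ E
  obtain ⟨e, he⟩ := exists_norm_eq (E := E) zero_le_one
  obtain ⟨x, hx, hmax⟩ := (isCompact_sphere (0 : E) 1).exists_isMaxOn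
    ⟨e, by simpa using he⟩ f.continuous.norm.continuousOn
  rw [mem_sphere_zero_iff_norm] at hx
  refine ⟨x, hx, le_antisymm (f.unit_le_opNorm x hx.le) ?_⟩
  exact ContinuousLinearMap.opNorm_le_of_unit_norm (norm_nonneg _) fun y hy =>
    hmax (by simpa using hy)

end Attainment

section Tuples

variable {d n : ℕ}

/-- The matrices of a tuple, acting on Euclidean space. -/
noncomputable def coordOps (A : Fin d → Matrix (Fin n) (Fin n) ℂ) :
    Fin d → EuclideanSpace ℂ (Fin n) →L[ℂ] EuclideanSpace ℂ (Fin n) :=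
  fun j => Matrix.toEuclideanCLM (n := Fin n) (𝕜 := ℂ) (A j)

theorem DoublyCommuting.pairwise_coordOps {A : Fin d → Matrix (Fin n) (Fin n) ℂ}
    (hA : DoublyCommuting A) : Pairwise fun i j => DoublyCommute (coordOps A i) (coordOps A j) :=
  fun i j hij => by
    have hstar : star (coordOps A i) = Matrix.toEuclideanCLM (n := Fin n) (𝕜 := ℂ) (star (A i)) :=
      (map_star _ _).symm
    exact ⟨Commute.map (hA i j hij).1 _, hstar ▸ Commute.map (hA i j hij).2 _⟩

theorem norm_tupleOp_apply_sq (A : Fin d → Matrix (Fin n) (Fin n) ℂ)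
    (x : EuclideanSpace ℂ (Fin n)) : ‖tupleOp A x‖ ^ 2 = ∑ j, ‖coordOps A j x‖ ^ 2 :=
  PiLp.norm_sq_eq_of_L2 _ _

theorem norm_tupleOp_sub_scalarTuple_apply_sq (A : Fin d → Matrix (Fin n) (Fin n) ℂ)
    (z : Fin d → ℂ) (x : EuclideanSpace ℂ (Fin n)) :
    ‖tupleOp (A - scalarTuple n z) x‖ ^ 2 = ∑ j, ‖coordOps A j x - z j • x‖ ^ 2 := by
  simp [norm_tupleOp_apply_sq, coordOps, scalarTuple]

theorem tupleVar_eq_sub_norm_expectation_sq (A : Fin d → Matrix (Fin n) (Fin n) ℂ)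
    (x : EuclideanSpace ℂ (Fin n)) :
    tupleVar A x = ∑ j, ‖coordOps A j x‖ ^ 2 - ‖expectation (coordOps A) x‖ ^ 2 := by
  rw [tupleVar, norm_tupleOp_apply_sq, EuclideanSpace.norm_sq_eq]
  rfl

theorem tupleVar_le_norm_tupleOp_sub_scalarTuple_sq (A : Fin d → Matrix (Fin n) (Fin n) ℂ)
    (z : Fin d → ℂ) {x : EuclideanSpace ℂ (Fin n)} (hx : ‖x‖ = 1) :
    tupleVar A x ≤ ‖tupleOp (A - scalarTuple n z)‖ ^ 2 :=
  calc tupleVar A x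
      ≤ ∑ j, ‖coordOps A j x - z j • x‖ ^ 2 := by
        rw [tupleVar_eq_sub_norm_expectation_sq, sum_norm_sub_smul_sq _ (WithLp.toLp 2 z) hx]
        exact le_add_of_nonneg_right (sq_nonneg _)
    _ = ‖tupleOp (A - scalarTuple n z) x‖ ^ 2 :=
        (norm_tupleOp_sub_scalarTuple_apply_sq A z x).symm
    _ ≤ ‖tupleOp (A - scalarTuple n z)‖ ^ 2 := by
        gcongr
        exact (tupleOp _).unit_le_opNorm x hx.le

theorem exists_minimal_norm_tupleOp_sub_scalarTuple (A : Fin d → Matrix (Fin n) (Fin n) ℂ) :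
    ∃ z : Fin d → ℂ, ∀ w : Fin d → ℂ,
      ‖tupleOp (A - scalarTuple n z)‖ ≤ ‖tupleOp (A - scalarTuple n w)‖ := by
  let L : (Fin d → ℂ) →ₗ[ℂ] EuclideanSpace ℂ (Fin n) →L[ℂ]
      PiLp 2 (fun _ : Fin d => EuclideanSpace ℂ (Fin n)) :=
    { toFun := fun z => tupleOp (scalarTuple n z)
      map_add' := fun z w => by
        ext x j i
        simp [tupleOp, scalarTuple, add_mul]
      map_smul' := fun r z => by
        ext x j i
        simp [tupleOp, scalarTuple, mul_assoc] }
  have hL : ∀ z, tupleOp (A - scalarTuple n z) = tupleOp A - L z := fun z => by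
    ext x j i
    simp [L, tupleOp]
  simpa only [hL] using exists_forall_norm_sub_le L (tupleOp A)

theorem exists_tupleVar_eq_of_minimal (hn : 0 < n) {A : Fin d → Matrix (Fin n) (Fin n) ℂ}
    (hA : DoublyCommuting A) {z : Fin d → ℂ}
    (hz : ∀ w, ‖tupleOp (A - scalarTuple n z)‖ ≤ ‖tupleOp (A - scalarTuple n w)‖) :
    ∃ x : EuclideanSpace ℂ (Fin n), ‖x‖ = 1 ∧
      tupleVar A x = ‖tupleOp (A - scalarTuple n z)‖ ^ 2 := by
  have : NeZero n := ⟨hn.ne'⟩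
  simp only [tupleVar_eq_sub_norm_expectation_sq]
  refine exists_variance_eq_of_minimal hA.pairwise_coordOps (z := WithLp.toLp 2 z)
    (fun x hx => ?_) fun w => ?_
  · rw [← norm_tupleOp_sub_scalarTuple_apply_sq]
    gcongr
    exact (tupleOp _).unit_le_opNorm x hx.le
  · obtain ⟨x, hx, hnorm⟩ := exists_norm_apply_eq_opNorm (tupleOp (A - scalarTuple n w))
    refine ⟨x, hx, ?_⟩
    rw [← norm_tupleOp_sub_scalarTuple_apply_sq, hnorm]
    exact pow_le_pow_left₀ (norm_nonneg _) (hz w) 2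

end Tuples

theorem theorem6 {d n : ℕ} (hn : 0 < n) (A : Fin d → Matrix (Fin n) (Fin n) ℂ)
    (hA : DoublyCommuting A) :
    IsLeast (Set.range fun z : Fin d → ℂ => ‖tupleOp (A - scalarTuple n z)‖) (distToScalars A) ∧
      IsGreatest {v : ℝ | ∃ x : EuclideanSpace ℂ (Fin n), ‖x‖ = 1 ∧ v = tupleVar A x}
        (distToScalars A ^ 2) := by
  obtain ⟨z, hz⟩ := exists_minimal_norm_tupleOp_sub_scalarTuple A
  have hleast : IsLeast (Set.range fun z : Fin d → ℂ => ‖tupleOp (A - scalarTuple n z)‖)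
      ‖tupleOp (A - scalarTuple n z)‖ := ⟨⟨z, rfl⟩, Set.forall_mem_range.mpr hz⟩
  have hdist : distToScalars A = ‖tupleOp (A - scalarTuple n z)‖ := hleast.csInf_eq
  rw [hdist]
  refine ⟨hleast, ?_, ?_⟩
  · obtain ⟨x, hx, hvar⟩ := exists_tupleVar_eq_of_minimal hn hA hz
    exact ⟨x, hx, hvar.symm⟩
  · rintro _ ⟨x, hx, rfl⟩
    exact tupleVar_le_norm_tupleOp_sub_scalarTuple_sq A z hx
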